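/- Let $n\ge 2$ and let $D\subset\mathbb{C}^n$ be a bounded domain (a non-empty connected open set). Then there are real constants $a\neq 0$ and $b$ such that the function $$G(z,v)=\|v\|^2\exp\Big(a\|z\|^2+b\,\frac{|\langle z,v\rangle|^2}{\|v\|^2}\Big)\quad(v\ne 0),\qquad G(z,0)=0,\qquad z\in D,\ v\in T^{1,0}_zD=\mathbb{C}^n,$$ has the following properties. (1) $G$ is a strongly pseudoconvex complex Finsler metric on $D$. That is, $G:T^{1,0}D\to[0,\infty)$ is continuous, it is $C^\infty$ away from the zero section, $G(z,v)=0$ if and only if $v=0$, $G(z,\zeta v)=|\zeta|^2G(z,v)$ for all $\zeta\in\mathbb{C}$, and the Levi matrix $(G_{\alpha\bar\beta})=\big(\partial^2G/\partial v^\alpha\partial\bar v^\beta\big)$ is positive definite at all $(z,v)$ with $v\neq0$. (2) $G$ is not Hermitian quadratic: there are no functions $g_{\alpha\bar\beta}$ on $D$ with $G(z,v)=\sum_{\alpha,\beta} g_{\alpha\bar\beta}(z)v^\alpha\bar v^\beta$ for all $z\in D$ and $v\in\mathbb{C}^n$. (3) The holomorphic sectional curvature of $G$ is bounded above by a negative constant: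 there is $K>0$ with $K_G(z,v)\le -K$ for all $z\in D$ and $v\neq 0$. Here $K_G(z,v)=\frac{2}{G(z,v)^2}\langle\Omega(\chi,\bar\chi)\chi,\chi\rangle_v$, where $\Omega$ is the curvature of the Chern–Finsler connection of $G$, $\chi=\sum_\alpha v^\alpha\delta_\alpha$ is the complex radial horizontal vector field, with $\delta_\alpha=\partial_{z^\alpha}-\sum_{\beta,\gamma}G^{\beta\bar\gamma}\frac{\partial^2G}{\partial z^\alpha\partial\bar v^\gamma}\,\partial_{v^\beta}$ and $(G^{\beta\bar\gamma})$ the inverse of the Levi matrix, and $\langle\delta_\alpha,\delta_\beta\rangle_v=G_{\alpha\bar\beta}(z,v)$. Moreover, (1), (2) and (3) hold for all real $a,b$ such that $b\neq0$, $a+b>0$ and $|b|\,\|z\|^2<1$ for all $z\in D$. -/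

import Mathlib

open scoped ContDiff ComplexConjugate ComplexOrder

noncomputable section

namespace ComplexFinsler

/-- Complex `n`-space with its standard Hermitian inner product and norm. -/
abbrev Cn (n : ℕ) : Type := EuclideanSpace ℂ (Fin n)

/-- The holomorphic tangent bundle of `ℂⁿ` in its global coordinates `(z; v)`.  For an open set `D`
of `ℂⁿ`, the bundle `T^{1,0}D` is the open subset `D ×ˢ univ`.  The same type also serves for
tangent vectors of type `(1,0)` at a point of the bundle, through their coordinates `(dz, dv)`. -/
abbrev TCn (n : ℕ) : Type := Cn n × Cn n

/-- The `α`-th vector of the standard basis of `ℂⁿ`. -/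
def stdVec {n : ℕ} (α : Fin n) : Cn n := EuclideanSpace.single α (1 : ℂ)

/-- The slit bundle over `D`: tangent vectors at points of `D`, the zero section removed. -/
def slitBundle {n : ℕ} (D : Set (Cn n)) : Set (TCn n) := {p | p.1 ∈ D ∧ p.2 ≠ 0}

/-! ### Wirtinger derivatives on the tangent bundle -/

/-- The Wirtinger derivative of type `(1,0)` along `X`; for the real coordinates `x + i y` in the
complex direction `X` it is `(∂/∂x - i ∂/∂y) / 2`. -/
def dHol {n : ℕ} (X : TCn n) (F : TCn n → ℂ) (p : TCn n) : ℂ :=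
  (1 / 2 : ℂ) * (fderiv ℝ F p X - Complex.I * fderiv ℝ F p (Complex.I • X))

/-- The Wirtinger derivative of type `(0,1)` along `X`, that is `(∂/∂x + i ∂/∂y) / 2`. -/
def dAnti {n : ℕ} (X : TCn n) (F : TCn n → ℂ) (p : TCn n) : ℂ :=
  (1 / 2 : ℂ) * (fderiv ℝ F p X + Complex.I * fderiv ℝ F p (Complex.I • X))

/-- `∂/∂z^α`. -/
def dz {n : ℕ} (α : Fin n) (F : TCn n → ℂ) : TCn n → ℂ := dHol (stdVec α, 0) F

/-- `∂/∂z̄^α`. -/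
def dzBar {n : ℕ} (α : Fin n) (F : TCn n → ℂ) : TCn n → ℂ := dAnti (stdVec α, 0) F

/-- `∂/∂v^α`. -/
def dv {n : ℕ} (α : Fin n) (F : TCn n → ℂ) : TCn n → ℂ := dHol (0, stdVec α) F

/-- `∂/∂v̄^α`. -/
def dvBar {n : ℕ} (α : Fin n) (F : TCn n → ℂ) : TCn n → ℂ := dAnti (0, stdVec α) F

/-! ### Complex Finsler metrics -/

/-- `G` is a complex Finsler metric on the open set `D` of `ℂⁿ`. -/
structure IsComplexFinslerMetric {n : ℕ} (D : Set (Cn n)) (G : TCn n → ℝ) : Prop where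
  continuousOn : ContinuousOn G (D ×ˢ Set.univ)
  smoothOn : ContDiffOn ℝ ∞ G (slitBundle D)
  nonneg : ∀ z ∈ D, ∀ v : Cn n, 0 ≤ G (z, v)
  eq_zero_iff : ∀ z ∈ D, ∀ v : Cn n, G (z, v) = 0 ↔ v = 0
  homogeneous : ∀ z ∈ D, ∀ (v : Cn n) (c : ℂ), G (z, c • v) = ‖c‖ ^ 2 * G (z, v)

/-- The entry `G_{αβ̄} = ∂²G / ∂v^α ∂v̄^β` of the Levi matrix, as a function on the bundle. -/
def leviEntry {n : ℕ} (G : TCn n → ℝ) (α β : Fin n) : TCn n → ℂ :=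
  dv α (dvBar β fun q => (G q : ℂ))

/-- The Levi matrix `(G_{αβ̄})` at a point of the bundle. -/
def leviMatrix {n : ℕ} (G : TCn n → ℝ) (p : TCn n) : Matrix (Fin n) (Fin n) ℂ :=
  Matrix.of fun α β => leviEntry G α β p

/-- A strongly pseudoconvex complex Finsler metric on `D`: the Levi matrix is positive definite on
the slit bundle. -/
structure IsStronglyPseudoconvex {n : ℕ} (D : Set (Cn n)) (G : TCn n → ℝ) : Prop
    extends IsComplexFinslerMetric D G where
  posDef : ∀ p ∈ slitBundle D, (leviMatrix G p).PosDef

/-- `G` is Hermitian quadratic on `D`: `G (z, v) = ∑ g_{αβ̄}(z) v^α v̄^β` for some coefficients.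
Nothing is asked of the coefficients: for a complex Finsler metric they are automatically a smooth
positive definite Hermitian tensor. -/
def IsHermitianQuadratic {n : ℕ} (D : Set (Cn n)) (G : TCn n → ℝ) : Prop :=
  ∃ g : Cn n → Matrix (Fin n) (Fin n) ℂ, ∀ z ∈ D, ∀ v : Cn n,
    (G (z, v) : ℂ) = ∑ α, ∑ β, g z α β * v α * conj (v β)

/-! ### The Chern-Finsler connection and its curvature -/

/-- `G^{αβ̄}`, determined by `∑_β G^{αβ̄} G_{γβ̄} = δ^α_γ`. -/
def leviInv {n : ℕ} (G : TCn n → ℝ) (α β : Fin n) (p : TCn n) : ℂ := (leviMatrix G p)⁻¹ β α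

/-- `Γ^β_{;α} = G^{βγ̄} G_{γ̄;α}`, where `G_{γ̄;α} = ∂²G / ∂z^α ∂v̄^γ`. -/
def nlConn {n : ℕ} (G : TCn n → ℝ) (β α : Fin n) (p : TCn n) : ℂ :=
  ∑ γ, leviInv G β γ p * dz α (dvBar γ fun q => (G q : ℂ)) p

/-- `δ_α = ∂_α - Γ^β_{;α} ∂̇_β`, as a differential operator. -/
def delta {n : ℕ} (G : TCn n → ℝ) (α : Fin n) (F : TCn n → ℂ) (p : TCn n) : ℂ :=
  dz α F p - ∑ β, nlConn G β α p * dv β F p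

/-- `δ_ᾱ`, the conjugate operator of `δ_α`. -/
def deltaBar {n : ℕ} (G : TCn n → ℝ) (α : Fin n) (F : TCn n → ℂ) (p : TCn n) : ℂ :=
  dzBar α F p - ∑ β, conj (nlConn G β α p) * dvBar β F p

/-- `Γ^α_{β;μ} = G^{ατ̄} δ_μ(G_{βτ̄})`. -/
def horConn {n : ℕ} (G : TCn n → ℝ) (α β μ : Fin n) (p : TCn n) : ℂ :=
  ∑ τ, leviInv G α τ p * delta G μ (leviEntry G β τ) p

/-- `Γ^α_{βγ} = G^{ατ̄} G_{βτ̄γ}`. -/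
def verConn {n : ℕ} (G : TCn n → ℝ) (α β γ : Fin n) (p : TCn n) : ℂ :=
  ∑ τ, leviInv G α τ p * dv γ (leviEntry G β τ) p

/-- `R^α_{β;μν̄} = -δ_ν̄(Γ^α_{β;μ}) - Γ^α_{βσ} δ_ν̄(Γ^σ_{;μ})`. -/
def curvHH {n : ℕ} (G : TCn n → ℝ) (α β μ ν : Fin n) (p : TCn n) : ℂ :=
  -deltaBar G ν (horConn G α β μ) p
    - ∑ σ, verConn G α β σ p * deltaBar G ν (nlConn G σ μ) p

/-- `R^α_{βδ;ν̄} = -δ_ν̄(Γ^α_{βδ})`. -/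
def curvVH {n : ℕ} (G : TCn n → ℝ) (α β δ ν : Fin n) (p : TCn n) : ℂ :=
  -deltaBar G ν (verConn G α β δ) p

/-- `R^α_{βγ̄;μ} = -∂̇_γ̄(Γ^α_{β;μ}) - Γ^α_{βσ} ∂̇_γ̄(Γ^σ_{;μ})`. -/
def curvHV {n : ℕ} (G : TCn n → ℝ) (α β γ μ : Fin n) (p : TCn n) : ℂ :=
  -dvBar γ (horConn G α β μ) p
    - ∑ σ, verConn G α β σ p * dvBar γ (nlConn G σ μ) p

/-- `R^α_{βδγ̄} = -∂̇_γ̄(Γ^α_{βδ})`. -/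
def curvVV {n : ℕ} (G : TCn n → ℝ) (α β δ γ : Fin n) (p : TCn n) : ℂ :=
  -dvBar γ (verConn G α β δ) p

/-- The form `ψ^γ = dv^γ + Γ^γ_{;μ} dz^μ` at `p`, evaluated on the `(1,0)`-vector `X`. -/
def psi {n : ℕ} (G : TCn n → ℝ) (p X : TCn n) (γ : Fin n) : ℂ :=
  X.2 γ + ∑ μ, nlConn G γ μ p * X.1 μ

/-- The curvature form of the Chern-Finsler connection at `p`, evaluated on `(X, Ȳ)` for
`(1,0)`-vectors `X` and `Y`: the value of
`Ω^α_β = R^α_{β;μν̄} dz^μ ∧ dz̄^ν + R^α_{βδ;ν̄} ψ^δ ∧ dz̄^ν + R^α_{βγ̄;μ} dz^μ ∧ ψ̄^γ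
  + R^α_{βδγ̄} ψ^δ ∧ ψ̄^γ`. -/
def curvForm {n : ℕ} (G : TCn n → ℝ) (p X Y : TCn n) (α β : Fin n) : ℂ :=
  ∑ i, ∑ j,
    (curvHH G α β i j p * X.1 i * conj (Y.1 j)
      + curvVH G α β i j p * psi G p X i * conj (Y.1 j)
      + curvHV G α β j i p * X.1 i * conj (psi G p Y j)
      + curvVV G α β i j p * psi G p X i * conj (psi G p Y j))

/-- The complex radial horizontal field `χ = v^α δ_α` at `p = (z; v)`. -/
def radialHor {n : ℕ} (G : TCn n → ℝ) (p : TCn n) : TCn n :=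
  (p.2, WithLp.toLp 2 fun β => -∑ α, nlConn G β α p * p.2 α)

/-- The holomorphic sectional curvature `K_G(v) = (2 / G(v)²) ⟨Ω(χ, χ̄)χ, χ⟩_v` at `p = (z; v)`.
The curvature acts on `χ = v^α δ_α` through the identification of `δ_α` with `∂̇_α`, in which
`⟨δ_α, δ_β⟩ = G_{αβ̄}`.  The pairing is real, so that taking its real part loses nothing. -/
def holSectCurv {n : ℕ} (G : TCn n → ℝ) (p : TCn n) : ℝ :=
  2 / G p ^ 2 *
    (∑ α, ∑ γ, leviEntry G α γ p
      * (∑ β, curvForm G p (radialHor G p) (radialHor G p) α β * p.2 β) * conj (p.2 γ)).re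

/-- The function `G(z, v) = ‖v‖² exp (a ‖z‖² + b |⟨z, v⟩|² / ‖v‖²)`, with `G(z, 0) = 0`. -/
def expMetric {n : ℕ} (a b : ℝ) : TCn n → ℝ := fun p =>
  ‖p.2‖ ^ 2 * Real.exp (a * ‖p.1‖ ^ 2 + b * (‖inner ℂ p.1 p.2‖ ^ 2 / ‖p.2‖ ^ 2))

end ComplexFinsler

end

namespace ComplexFinsler

variable {n : ℕ}

/-! ### Calculus with Wirtinger derivatives -/

section Wirtinger

variable {F H : TCn n → ℂ} {p : TCn n} {U : Set (TCn n)} (X : TCn n)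

/-! Write `θ = |⟨z, v⟩|² / ‖v‖²`. Here `⟨z, v⟩` is holomorphic in `v` and antiholomorphic in `z`, so
every derivative of `G` is explicit.

Curvature: Euler's identity `∑ G_{βτ̄} v^β = G_τ̄` reduces `Ω(χ, χ̄)χ` to the derivatives `-v̄^ν
δ_ν̄(Γ^α_{;μ} v^μ)` (`sum_curvForm_radialHor_mul`). For this metric, `∑ G_{τ̄;μ} v^μ = (a + b) ⟨z,
v⟩ G_τ̄` (`sum_dz_dvBar_expMetric_mul`). Applying the inverse Levi matrix and Euler's identity again
gives `Γ^α_{;μ} v^μ = (a + b) ⟨z, v⟩ v^α`. Hence `Ω(χ, χ̄)χ = -(a + b) ‖v‖² χ` and `K_G = -2 (a + b)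
‖v‖² / G` (`holSectCurv_expMetric`). The factor `G / ‖v‖²` is bounded above on a bounded domain, so
`a + b > 0` suffices.

Positivity: up to a positive factor the Levi matrix is `(1 - bθ) I` plus `b` times a rank-one form
in `z` plus a nonnegative rank-one form. Since `θ ≤ ‖z‖²`, Cauchy–Schwarz and `|b| ‖z‖² < 1` make it
positive definite (`posDef_leviMatrix_expMetric`).

Not quadratic: the parallelogram law fails for `z` and an orthogonal vector of the same length
(`not_isHermitianQuadratic_expMetric`). -/

lemma dHol_congr (h : F =ᶠ[nhds p] H) : dHol X F p = dHol X H p := by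
  simp only [dHol, h.fderiv_eq]

lemma dAnti_congr (h : F =ᶠ[nhds p] H) : dAnti X F p = dAnti X H p := by
  simp only [dAnti, h.fderiv_eq]

lemma dHol_add (hF : DifferentiableAt ℝ F p) (hH : DifferentiableAt ℝ H p) :
    dHol X (fun q => F q + H q) p = dHol X F p + dHol X H p := by
  simp only [dHol, fderiv_fun_add hF hH, add_apply]
  ring

lemma dAnti_add (hF : DifferentiableAt ℝ F p) (hH : DifferentiableAt ℝ H p) :
    dAnti X (fun q => F q + H q) p = dAnti X F p + dAnti X H p := by
  simp only [dAnti, fderiv_fun_add hF hH, add_apply]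
  ring

lemma dHol_sub (hF : DifferentiableAt ℝ F p) (hH : DifferentiableAt ℝ H p) :
    dHol X (fun q => F q - H q) p = dHol X F p - dHol X H p := by
  simp only [dHol, fderiv_fun_sub hF hH, sub_apply]
  ring

lemma dHol_mul (hF : DifferentiableAt ℝ F p) (hH : DifferentiableAt ℝ H p) :
    dHol X (fun q => F q * H q) p = dHol X F p * H p + F p * dHol X H p := by
  simp only [dHol, fderiv_fun_mul hF hH, add_apply, smul_apply, smul_eq_mul]
  ring

lemma dAnti_mul (hF : DifferentiableAt ℝ F p) (hH : DifferentiableAt ℝ H p) :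
    dAnti X (fun q => F q * H q) p = dAnti X F p * H p + F p * dAnti X H p := by
  simp only [dAnti, fderiv_fun_mul hF hH, add_apply, smul_apply, smul_eq_mul]
  ring

lemma dHol_const (c : ℂ) : dHol X (fun _ => c) p = 0 := by simp [dHol]

lemma dAnti_const (c : ℂ) : dAnti X (fun _ => c) p = 0 := by simp [dAnti]

lemma dHol_const_mul (c : ℂ) (hF : DifferentiableAt ℝ F p) :
    dHol X (fun q => c * F q) p = c * dHol X F p := by
  rw [dHol_mul X (differentiableAt_const c) hF, dHol_const]; ring

lemma dAnti_const_mul (c : ℂ) (hF : DifferentiableAt ℝ F p) :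
    dAnti X (fun q => c * F q) p = c * dAnti X F p := by
  rw [dAnti_mul X (differentiableAt_const c) hF, dAnti_const]; ring

lemma dHol_sum {ι : Type*} (s : Finset ι) {f : ι → TCn n → ℂ}
    (hf : ∀ i ∈ s, DifferentiableAt ℝ (f i) p) :
    dHol X (fun q => ∑ i ∈ s, f i q) p = ∑ i ∈ s, dHol X (f i) p := by
  simp only [dHol, fderiv_fun_sum hf, sum_apply, Finset.mul_sum,
    ← Finset.sum_sub_distrib]

lemma dAnti_sum {ι : Type*} (s : Finset ι) {f : ι → TCn n → ℂ}
    (hf : ∀ i ∈ s, DifferentiableAt ℝ (f i) p) :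
    dAnti X (fun q => ∑ i ∈ s, f i q) p = ∑ i ∈ s, dAnti X (f i) p := by
  simp only [dAnti, fderiv_fun_sum hf, sum_apply, Finset.mul_sum,
    ← Finset.sum_add_distrib]

lemma dHol_cexp (hF : DifferentiableAt ℝ F p) :
    dHol X (fun q => Complex.exp (F q)) p = Complex.exp (F p) * dHol X F p := by
  simp only [dHol, hF.hasFDerivAt.cexp.fderiv, smul_apply, smul_eq_mul]
  ring

lemma dAnti_cexp (hF : DifferentiableAt ℝ F p) :
    dAnti X (fun q => Complex.exp (F q)) p = Complex.exp (F p) * dAnti X F p := by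
  simp only [dAnti, hF.hasFDerivAt.cexp.fderiv, smul_apply, smul_eq_mul]
  ring

/-- The quotient rule, in the form of a linear equation. -/
lemma dHol_div (hF : DifferentiableAt ℝ F p) (hH : DifferentiableAt ℝ H p) (h0 : H p ≠ 0) :
    dHol X (fun q => F q / H q) p = (dHol X F p - F p / H p * dHol X H p) / H p := by
  have hq : DifferentiableAt ℝ (fun q => F q / H q) p := by
    simpa only [div_eq_mul_inv] using hF.fun_mul (hH.fun_inv h0)
  have h := dHol_mul X hq hH
  rw [dHol_congr X (H := F)] at h
  · rw [h]; field_simp; ring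
  · filter_upwards [hH.continuousAt.eventually_ne h0] with q hq'
    exact div_mul_cancel₀ _ hq'

lemma dAnti_div (hF : DifferentiableAt ℝ F p) (hH : DifferentiableAt ℝ H p) (h0 : H p ≠ 0) :
    dAnti X (fun q => F q / H q) p = (dAnti X F p - F p / H p * dAnti X H p) / H p := by
  have hq : DifferentiableAt ℝ (fun q => F q / H q) p := by
    simpa only [div_eq_mul_inv] using hF.fun_mul (hH.fun_inv h0)
  have h := dAnti_mul X hq hH
  rw [dAnti_congr X (H := F)] at h
  · rw [h]; field_simp; ring
  · filter_upwards [hH.continuousAt.eventually_ne h0] with q hq'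
    exact div_mul_cancel₀ _ hq'

lemma dHol_clm (f : TCn n →L[ℂ] ℂ) : dHol X (fun q => f q) p = f X := by
  have h : fderiv ℝ (fun q => f q) p = f.restrictScalars ℝ :=
    (f.restrictScalars ℝ).hasFDerivAt.fderiv
  simp only [dHol, h, ContinuousLinearMap.coe_restrictScalars', map_smul, smul_eq_mul]
  linear_combination (-1 / 2 * f X) * Complex.I_mul_I

lemma dAnti_clm (f : TCn n →L[ℂ] ℂ) : dAnti X (fun q => f q) p = 0 := by
  have h : fderiv ℝ (fun q => f q) p = f.restrictScalars ℝ :=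
    (f.restrictScalars ℝ).hasFDerivAt.fderiv
  simp only [dAnti, h, ContinuousLinearMap.coe_restrictScalars', map_smul, smul_eq_mul]
  linear_combination (1 / 2 * f X) * Complex.I_mul_I

lemma fderiv_inner_clm (f g : TCn n →L[ℂ] Cn n) (Y : TCn n) :
    fderiv ℝ (fun q => inner ℂ (f q) (g q)) p Y = inner ℂ (f p) (g Y) + inner ℂ (f Y) (g p) := by
  have hf : HasFDerivAt (fun q => f q) (f.restrictScalars ℝ) p :=
    (f.restrictScalars ℝ).hasFDerivAt
  have hg : HasFDerivAt (fun q => g q) (g.restrictScalars ℝ) p :=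
    (g.restrictScalars ℝ).hasFDerivAt
  rw [fderiv_inner_apply ℂ hf.differentiableAt hg.differentiableAt, hf.fderiv, hg.fderiv]
  rfl

/-- The inner product is conjugate-linear in its first slot, so a `(1,0)`-derivative sees only the
second slot. -/
lemma dHol_inner (f g : TCn n →L[ℂ] Cn n) :
    dHol X (fun q => inner ℂ (f q) (g q)) p = inner ℂ (f p) (g X) := by
  simp only [dHol, fderiv_inner_clm, map_smul, inner_smul_left, inner_smul_right, Complex.conj_I]
  linear_combination (-1 / 2 * inner ℂ (f p) (g X) + 1 / 2 * inner ℂ (f X) (g p)) * Complex.I_mul_I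

lemma dAnti_inner (f g : TCn n →L[ℂ] Cn n) :
    dAnti X (fun q => inner ℂ (f q) (g q)) p = inner ℂ (f X) (g p) := by
  simp only [dAnti, fderiv_inner_clm, map_smul, inner_smul_left, inner_smul_right, Complex.conj_I]
  linear_combination (1 / 2 * inner ℂ (f p) (g X) - 1 / 2 * inner ℂ (f X) (g p)) * Complex.I_mul_I

/-- Although `fderiv ℝ` is only real-linear, `dHol` is complex-linear in the direction. A
contraction of coordinate derivatives thus becomes a single directional derivative. -/
lemma dHol_vec_sum {ι : Type*} (s : Finset ι) (c : ι → ℂ) (Y : ι → TCn n) :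
    ∑ i ∈ s, c i * dHol (Y i) F p = dHol (∑ i ∈ s, c i • Y i) F p := by
  have key : ∀ (c : ℂ) (Y : TCn n), dHol (c • Y) F p = c * dHol Y F p := by
    intro c Y
    have h1 : c • Y = c.re • Y + c.im • (Complex.I • Y) := by
      conv_lhs => rw [← Complex.re_add_im c, add_smul, mul_smul]
      simp only [Complex.coe_smul]
    have h2 : Complex.I • c • Y = c.re • (Complex.I • Y) - c.im • Y := by
      rw [h1, smul_add, smul_comm Complex.I c.re, smul_comm Complex.I c.im, smul_smul,
        Complex.I_mul_I, neg_one_smul, smul_neg, sub_eq_add_neg]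
    rw [dHol, dHol, h2, h1]
    simp only [map_add, map_sub, map_smul, Complex.real_smul]
    conv_rhs => rw [← Complex.re_add_im c]
    linear_combination
      (1 / 2 * c.im * fderiv ℝ F p (Complex.I • Y)) * Complex.I_mul_I
  have hadd : ∀ Y Z : TCn n, dHol (Y + Z) F p = dHol Y F p + dHol Z F p := by
    intro Y Z
    simp only [dHol, smul_add, map_add]; ring
  have h0 : dHol 0 F p = 0 := by simp [dHol]
  classical
  induction s using Finset.induction_on with
  | empty => simp [h0]
  | insert i s hi ih => rw [Finset.sum_insert hi, Finset.sum_insert hi, hadd, key, ih]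

lemma dAnti_vec_sum {ι : Type*} (s : Finset ι) (c : ι → ℂ) (Y : ι → TCn n) :
    ∑ i ∈ s, conj (c i) * dAnti (Y i) F p = dAnti (∑ i ∈ s, c i • Y i) F p := by
  have key : ∀ (c : ℂ) (Y : TCn n), dAnti (c • Y) F p = conj c * dAnti Y F p := by
    intro c Y
    have h1 : c • Y = c.re • Y + c.im • (Complex.I • Y) := by
      conv_lhs => rw [← Complex.re_add_im c, add_smul, mul_smul]
      simp only [Complex.coe_smul]
    have h2 : Complex.I • c • Y = c.re • (Complex.I • Y) - c.im • Y := by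
      rw [h1, smul_add, smul_comm Complex.I c.re, smul_comm Complex.I c.im, smul_smul,
        Complex.I_mul_I, neg_one_smul, smul_neg, sub_eq_add_neg]
    rw [dAnti, dAnti, h2, h1]
    simp only [map_add, map_sub, map_smul, Complex.real_smul]
    conv_rhs => rw [← Complex.re_add_im c]
    simp only [map_add, map_mul, Complex.conj_ofReal, Complex.conj_I]
    linear_combination
      (1 / 2 * c.im * fderiv ℝ F p (Complex.I • Y)) * Complex.I_mul_I
  have hadd : ∀ Y Z : TCn n, dAnti (Y + Z) F p = dAnti Y F p + dAnti Z F p := by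
    intro Y Z
    simp only [dAnti, smul_add, map_add]; ring
  have h0 : dAnti 0 F p = 0 := by simp [dAnti]
  classical
  induction s using Finset.induction_on with
  | empty => simp [h0]
  | insert i s hi ih => rw [Finset.sum_insert hi, Finset.sum_insert hi, hadd, key, ih]

lemma contDiffOn_dHol (hU : IsOpen U) (hF : ContDiffOn ℝ ∞ F U) : ContDiffOn ℝ ∞ (dHol X F) U := by
  have h := hF.fderiv_of_isOpen hU (m := ∞) (by simp)
  exact contDiffOn_const.mul ((h.clm_apply contDiffOn_const).sub
    (contDiffOn_const.mul (h.clm_apply contDiffOn_const)))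

lemma contDiffOn_dAnti (hU : IsOpen U) (hF : ContDiffOn ℝ ∞ F U) :
    ContDiffOn ℝ ∞ (dAnti X F) U := by
  have h := hF.fderiv_of_isOpen hU (m := ∞) (by simp)
  exact contDiffOn_const.mul ((h.clm_apply contDiffOn_const).add
    (contDiffOn_const.mul (h.clm_apply contDiffOn_const)))

end Wirtinger

/-! ### Coordinate functions as holomorphic functions on the bundle -/

section Coordinates

variable {p : TCn n} (X : TCn n) (i : Fin n)

lemma differentiable_inner_clm (f g : TCn n →L[ℂ] Cn n) :
    Differentiable ℝ (fun q => inner ℂ (f q) (g q)) :=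
  (f.restrictScalars ℝ).differentiable.inner ℂ (g.restrictScalars ℝ).differentiable

/-- The coordinate `v^i` as a complex linear map. -/
noncomputable def vCoord (i : Fin n) : TCn n →L[ℂ] ℂ :=
  (EuclideanSpace.proj i).comp (ContinuousLinearMap.snd ℂ (Cn n) (Cn n))

/-- The coordinate `z^i` as a complex linear map. -/
noncomputable def zCoord (i : Fin n) : TCn n →L[ℂ] ℂ :=
  (EuclideanSpace.proj i).comp (ContinuousLinearMap.fst ℂ (Cn n) (Cn n))

lemma differentiable_v : Differentiable ℝ (fun q : TCn n => q.2 i) :=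
  ((vCoord i).restrictScalars ℝ).differentiable

lemma differentiable_z : Differentiable ℝ (fun q : TCn n => q.1 i) :=
  ((zCoord i).restrictScalars ℝ).differentiable

lemma dHol_v : dHol X (fun q => q.2 i) p = X.2 i := dHol_clm X (vCoord i)

lemma dAnti_v : dAnti X (fun q => q.2 i) p = 0 := dAnti_clm X (vCoord i)

lemma dHol_z : dHol X (fun q => q.1 i) p = X.1 i := dHol_clm X (zCoord i)

end Coordinates

/-! ### The Chern-Finsler connection in the radial direction -/

section Connection

lemma sum_smul_stdVec_right (w : Cn n) : ∑ β, w β • ((0, stdVec β) : TCn n) = (0, w) := by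
  ext i
  · simp [Prod.fst_sum]
  · simp [Prod.snd_sum, stdVec, Pi.single_apply]

lemma sum_smul_stdVec_left (w : Cn n) : ∑ β, w β • ((stdVec β, 0) : TCn n) = (w, 0) := by
  ext i
  · simp [Prod.fst_sum, stdVec, Pi.single_apply]
  · simp [Prod.snd_sum]

/-- The vector `δ_α` at `p` in coordinates. -/
noncomputable def deltaVec (G : TCn n → ℝ) (α : Fin n) (p : TCn n) : TCn n :=
  (stdVec α, WithLp.toLp 2 fun β => -nlConn G β α p)

/-- Indexing by `Option` puts the base vector and the vertical vectors into one sum, so that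
`dHol_vec_sum` and `dAnti_vec_sum` apply. -/
lemma deltaVec_eq (G : TCn n → ℝ) (α : Fin n) (p : TCn n) :
    deltaVec G α p = ∑ o : Option (Fin n), (o.elim 1 fun β => -nlConn G β α p) •
      (o.elim (stdVec α, 0) fun β => (0, stdVec β) : TCn n) := by
  rw [Fintype.sum_option]
  simp only [Option.elim, one_smul]
  have h := sum_smul_stdVec_right (WithLp.toLp 2 fun β => -nlConn G β α p : Cn n)
  simp only at h
  rw [h]
  simp [deltaVec]

lemma delta_eq_dHol (G : TCn n → ℝ) (α : Fin n) (F : TCn n → ℂ) (p : TCn n) :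
    delta G α F p = dHol (deltaVec G α p) F p := by
  rw [deltaVec_eq, ← dHol_vec_sum, Fintype.sum_option]
  simp [delta, dz, dv, sub_eq_add_neg]

lemma deltaBar_eq_dAnti (G : TCn n → ℝ) (α : Fin n) (F : TCn n → ℂ) (p : TCn n) :
    deltaBar G α F p = dAnti (deltaVec G α p) F p := by
  rw [deltaVec_eq, ← dAnti_vec_sum, Fintype.sum_option]
  simp [deltaBar, dzBar, dvBar, sub_eq_add_neg]

variable {G : TCn n → ℝ} {U : Set (TCn n)} {p : TCn n}

lemma sum_leviInv_mul_leviEntry (hL : IsUnit (leviMatrix G p).det) (α β : Fin n) :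
    ∑ τ, leviInv G α τ p * leviEntry G β τ p = if α = β then 1 else 0 := by
  have h := congrFun (congrFun (Matrix.mul_nonsing_inv _ hL) β) α
  rw [Matrix.mul_apply, Matrix.one_apply] at h
  simp only [eq_comm (a := α), ← h]
  exact Finset.sum_congr rfl fun τ _ => mul_comm _ _

section Smooth

variable (hU : IsOpen U) (hG : ContDiffOn ℝ ∞ (fun q => (G q : ℂ)) U)
  (hL : ∀ q ∈ U, IsUnit (leviMatrix G q).det)
include hU hG

lemma contDiffOn_leviEntry (α β : Fin n) : ContDiffOn ℝ ∞ (leviEntry G α β) U :=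
  contDiffOn_dHol _ hU (contDiffOn_dAnti _ hU hG)

include hL

lemma contDiffOn_leviInv (α β : Fin n) : ContDiffOn ℝ ∞ (leviInv G α β) U := by
  have hdet : ∀ M : TCn n → Matrix (Fin n) (Fin n) ℂ,
      (∀ i j, ContDiffOn ℝ ∞ (fun q => M q i j) U) → ContDiffOn ℝ ∞ (fun q => (M q).det) U := by
    intro M hM
    simp only [Matrix.det_apply']
    exact ContDiffOn.sum fun σ _ => contDiffOn_const.mul (contDiffOn_prod fun i _ => hM _ _)
  have h1 : ∀ i j, ContDiffOn ℝ ∞ (fun q => leviMatrix G q i j) U :=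
    contDiffOn_leviEntry hU hG
  -- Cramer's rule: the inverse is a quotient of determinants, which are polynomial in the smooth
  -- entries.
  have heq : leviInv G α β = fun q => ((leviMatrix G q).det)⁻¹ *
      ((leviMatrix G q).updateRow α (Pi.single β 1)).det := by
    funext q
    rw [leviInv, Matrix.inv_def, Matrix.smul_apply, Matrix.adjugate_apply, Ring.inverse_eq_inv',
      smul_eq_mul]
  rw [heq]
  refine ((hdet _ h1).inv fun q hq => (hL q hq).ne_zero).mul (hdet _ fun i j => ?_)
  by_cases hi : i = α
  · subst hi
    simp only [Matrix.updateRow_self]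
    exact contDiffOn_const
  · simp only [Matrix.updateRow_ne hi]
    exact h1 i j

lemma contDiffOn_nlConn (α β : Fin n) : ContDiffOn ℝ ∞ (nlConn G α β) U :=
  ContDiffOn.sum fun γ _ => (contDiffOn_leviInv hU hG hL α γ).mul
    (contDiffOn_dHol _ hU (contDiffOn_dAnti _ hU hG))

lemma contDiffOn_horConn (α β μ : Fin n) : ContDiffOn ℝ ∞ (horConn G α β μ) U :=
  ContDiffOn.sum fun τ _ => (contDiffOn_leviInv hU hG hL α τ).mul <|
    (contDiffOn_dHol _ hU (contDiffOn_leviEntry hU hG β τ)).sub <| ContDiffOn.sum fun σ _ =>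
      (contDiffOn_nlConn hU hG hL σ μ).mul (contDiffOn_dHol _ hU (contDiffOn_leviEntry hU hG β τ))

end Smooth

/-- The field `χ` is horizontal, so the forms `ψ` vanish on it and only the `dz ∧ dz̄` part
survives. -/
lemma curvForm_radialHor (G : TCn n → ℝ) (p : TCn n) (α β : Fin n) :
    curvForm G p (radialHor G p) (radialHor G p) α β =
      ∑ i, ∑ j, curvHH G α β i j p * p.2 i * conj (p.2 j) := by
  have h : ∀ γ, psi G p (radialHor G p) γ = 0 := fun γ => by simp [psi, radialHor]
  simp only [curvForm, h, map_zero, mul_zero, zero_mul, add_zero]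
  rfl

variable (hU : IsOpen U) (hG : ContDiffOn ℝ ∞ (fun q => (G q : ℂ)) U)
  (hL : ∀ q ∈ U, IsUnit (leviMatrix G q).det)
  (hE : ∀ q ∈ U, ∀ τ, ∑ β, leviEntry G β τ q * q.2 β = dvBar τ (fun q => (G q : ℂ)) q)

lemma _root_.ContDiffOn.differentiableAt_of_isOpen {E F : Type*} [NormedAddCommGroup E]
    [NormedSpace ℝ E] [NormedAddCommGroup F] [NormedSpace ℝ F] {f : E → F} {s : Set E} {x : E}
    (hf : ContDiffOn ℝ ∞ f s) (hs : IsOpen s) (hx : x ∈ s) : DifferentiableAt ℝ f x :=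
  (hf.contDiffAt (hs.mem_nhds hx)).differentiableAt (by simp)

include hU hG hE

/-- The product rule for Euler's identity `hE`. Every contraction below comes from a choice of `X`.
-/
lemma sum_dHol_leviEntry_mul (hp : p ∈ U) (X : TCn n) (τ : Fin n) :
    ∑ β, dHol X (leviEntry G β τ) p * p.2 β =
      dHol X (dvBar τ fun q => (G q : ℂ)) p - ∑ β, leviEntry G β τ p * X.2 β := by
  have hd : ∀ β, DifferentiableAt ℝ (leviEntry G β τ) p := fun β =>
    (contDiffOn_leviEntry hU hG β τ).differentiableAt_of_isOpen hU hp
  rw [← dHol_congr X (Filter.eventually_of_mem (hU.mem_nhds hp) fun q hq => hE q hq τ),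
    dHol_sum X _ fun β _ => (hd β).fun_mul (differentiable_v β p), ← Finset.sum_sub_distrib]
  refine Finset.sum_congr rfl fun β _ => ?_
  rw [dHol_mul X (hd β) (differentiable_v β p), dHol_v]
  ring

/-- For `X = ∂/∂v^σ` both terms on the right of `sum_dHol_leviEntry_mul` equal `G_{στ̄}`. -/
lemma sum_verConn_mul (hp : p ∈ U) (α σ : Fin n) : ∑ β, verConn G α β σ p * p.2 β = 0 := by
  have h : ∀ τ, ∑ β, dv σ (leviEntry G β τ) p * p.2 β = 0 := fun τ => by
    have := sum_dHol_leviEntry_mul hU hG hE hp (0, stdVec σ) τ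
    change ∑ β, dHol (0, stdVec σ) (leviEntry G β τ) p * p.2 β = 0
    rw [this]
    simp [stdVec, leviEntry, dv]
  simp only [verConn, Finset.sum_mul]
  rw [Finset.sum_comm]
  simp only [mul_assoc, ← Finset.mul_sum, h, mul_zero, Finset.sum_const_zero]

/-- For `X = δ_μ` the vertical part of `δ_μ(G_τ̄)` cancels the correction term, which leaves
`G_{τ̄;μ}`. -/
lemma sum_horConn_mul (hp : p ∈ U) (α μ : Fin n) :
    ∑ β, horConn G α β μ p * p.2 β = nlConn G α μ p := by
  have h : ∀ τ, ∑ β, delta G μ (leviEntry G β τ) p * p.2 β =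
      dz μ (dvBar τ fun q => (G q : ℂ)) p := fun τ => by
    have h1 := sum_dHol_leviEntry_mul hU hG hE hp (deltaVec G μ p) τ
    rw [← delta_eq_dHol] at h1
    simp only [← delta_eq_dHol] at h1
    rw [h1, delta]
    simp [deltaVec, leviEntry, mul_comm]
  simp only [horConn, Finset.sum_mul]
  rw [Finset.sum_comm]
  simp only [mul_assoc, ← Finset.mul_sum, h]
  rfl

include hL

/-- The coordinates `v^β` are annihilated by `δ_ν̄`, so they move inside it; the vertical correction
dies by `sum_verConn_mul`. -/
lemma sum_curvHH_mul (hp : p ∈ U) (α μ ν : Fin n) :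
    ∑ β, curvHH G α β μ ν p * p.2 β = -deltaBar G ν (nlConn G α μ) p := by
  have hd : ∀ β, DifferentiableAt ℝ (horConn G α β μ) p := fun β =>
    (contDiffOn_horConn hU hG hL α β μ).differentiableAt_of_isOpen hU hp
  have h1 : ∑ β, deltaBar G ν (horConn G α β μ) p * p.2 β = deltaBar G ν (nlConn G α μ) p := by
    simp only [deltaBar_eq_dAnti]
    rw [← dAnti_congr _ (Filter.eventually_of_mem (hU.mem_nhds hp) fun q hq =>
      sum_horConn_mul hU hG hE hq α μ),
      dAnti_sum _ _ fun β _ => (hd β).fun_mul (differentiable_v β p)]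
    refine Finset.sum_congr rfl fun β _ => ?_
    rw [dAnti_mul _ (hd β) (differentiable_v β p), dAnti_v, mul_zero, add_zero]
  have h2 : ∑ β, (∑ σ, verConn G α β σ p * deltaBar G ν (nlConn G σ μ) p) * p.2 β = 0 := by
    simp only [Finset.sum_mul]
    rw [Finset.sum_comm]
    refine Finset.sum_eq_zero fun σ _ => ?_
    simp only [mul_right_comm _ _ (p.2 _)]
    rw [← Finset.sum_mul, sum_verConn_mul hU hG hE hp, zero_mul]
  simp only [curvHH, sub_mul, neg_mul, Finset.sum_sub_distrib, Finset.sum_neg_distrib, h1, h2,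
    sub_zero]

/-- In the radial direction the curvature is determined by the functions `Γ^α_{;μ} v^μ`. -/
lemma sum_curvForm_radialHor_mul (hp : p ∈ U) (α : Fin n) :
    ∑ β, curvForm G p (radialHor G p) (radialHor G p) α β * p.2 β =
      -∑ ν, dAnti (deltaVec G ν p) (fun q => ∑ μ, nlConn G α μ q * q.2 μ) p * conj (p.2 ν) := by
  have hd : ∀ μ, DifferentiableAt ℝ (nlConn G α μ) p := fun μ =>
    (contDiffOn_nlConn hU hG hL α μ).differentiableAt_of_isOpen hU hp
  have h1 : ∀ ν, dAnti (deltaVec G ν p) (fun q => ∑ μ, nlConn G α μ q * q.2 μ) p =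
      ∑ μ, deltaBar G ν (nlConn G α μ) p * p.2 μ := fun ν => by
    rw [dAnti_sum _ _ fun μ _ => (hd μ).fun_mul (differentiable_v μ p)]
    refine Finset.sum_congr rfl fun μ _ => ?_
    rw [dAnti_mul _ (hd μ) (differentiable_v μ p), dAnti_v, mul_zero, add_zero, deltaBar_eq_dAnti]
  have h2 : ∀ ν μ, deltaBar G ν (nlConn G α μ) p = -∑ β, curvHH G α β μ ν p * p.2 β :=
    fun ν μ => by rw [sum_curvHH_mul hU hG hL hE hp, neg_neg]
  simp only [h1, h2, curvForm_radialHor, Finset.sum_mul, neg_mul, Finset.sum_neg_distrib, neg_neg]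
  rw [Finset.sum_comm_cycle]
  refine Finset.sum_congr rfl fun ν _ => ?_
  rw [Finset.sum_comm]
  refine Finset.sum_congr rfl fun μ _ => Finset.sum_congr rfl fun β _ => ?_
  ring

end Connection

/-! ### The exponential metric -/

section ExpMetric

variable (a b : ℝ) {p : TCn n} (X : TCn n)

/-- The quotient `|⟨z, v⟩|² / ‖v‖²`. -/
noncomputable def angle (q : TCn n) : ℂ := inner ℂ q.1 q.2 * inner ℂ q.2 q.1 / inner ℂ q.2 q.2

/-- The exponential factor of the metric. -/
noncomputable def weight (q : TCn n) : ℂ :=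
  Complex.exp (a * inner ℂ q.1 q.1 + b * angle q)

lemma angle_eq (q : TCn n) : angle q = ((‖inner ℂ q.1 q.2‖ ^ 2 / ‖q.2‖ ^ 2 : ℝ) : ℂ) := by
  rw [angle, ← inner_conj_symm q.2 q.1, Complex.mul_conj', inner_self_eq_norm_sq_to_K]
  push_cast
  rfl

lemma weight_eq (q : TCn n) : weight a b q =
    (Real.exp (a * ‖q.1‖ ^ 2 + b * (‖inner ℂ q.1 q.2‖ ^ 2 / ‖q.2‖ ^ 2)) : ℂ) := by
  rw [weight, angle_eq, inner_self_eq_norm_sq_to_K]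
  push_cast
  rfl

/-- Norms are traded for inner products, to which the Wirtinger rules apply. -/
lemma ofReal_expMetric (q : TCn n) :
    (expMetric a b q : ℂ) = inner ℂ q.2 q.2 * weight a b q := by
  rw [weight_eq, inner_self_eq_norm_sq_to_K, expMetric]
  push_cast
  rfl

lemma differentiable_inner_zv : Differentiable ℝ (fun q : TCn n => inner ℂ q.1 q.2) :=
  differentiable_inner_clm (ContinuousLinearMap.fst ℂ _ _) (ContinuousLinearMap.snd ℂ _ _)

lemma differentiable_inner_vz : Differentiable ℝ (fun q : TCn n => inner ℂ q.2 q.1) :=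
  differentiable_inner_clm (ContinuousLinearMap.snd ℂ _ _) (ContinuousLinearMap.fst ℂ _ _)

lemma differentiable_inner_vv : Differentiable ℝ (fun q : TCn n => inner ℂ q.2 q.2) :=
  differentiable_inner_clm (ContinuousLinearMap.snd ℂ _ _) (ContinuousLinearMap.snd ℂ _ _)

lemma differentiable_inner_zz : Differentiable ℝ (fun q : TCn n => inner ℂ q.1 q.1) :=
  differentiable_inner_clm (ContinuousLinearMap.fst ℂ _ _) (ContinuousLinearMap.fst ℂ _ _)

lemma dHol_inner_zv : dHol X (fun q => inner ℂ q.1 q.2) p = inner ℂ p.1 X.2 :=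
  dHol_inner X (ContinuousLinearMap.fst ℂ _ _) (ContinuousLinearMap.snd ℂ _ _)

lemma dHol_inner_vz : dHol X (fun q => inner ℂ q.2 q.1) p = inner ℂ p.2 X.1 :=
  dHol_inner X (ContinuousLinearMap.snd ℂ _ _) (ContinuousLinearMap.fst ℂ _ _)

lemma dHol_inner_vv : dHol X (fun q => inner ℂ q.2 q.2) p = inner ℂ p.2 X.2 :=
  dHol_inner X (ContinuousLinearMap.snd ℂ _ _) (ContinuousLinearMap.snd ℂ _ _)

lemma dHol_inner_zz : dHol X (fun q => inner ℂ q.1 q.1) p = inner ℂ p.1 X.1 :=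
  dHol_inner X (ContinuousLinearMap.fst ℂ _ _) (ContinuousLinearMap.fst ℂ _ _)

lemma dAnti_inner_zv : dAnti X (fun q => inner ℂ q.1 q.2) p = inner ℂ X.1 p.2 :=
  dAnti_inner X (ContinuousLinearMap.fst ℂ _ _) (ContinuousLinearMap.snd ℂ _ _)

lemma dAnti_inner_vz : dAnti X (fun q => inner ℂ q.2 q.1) p = inner ℂ X.2 p.1 :=
  dAnti_inner X (ContinuousLinearMap.snd ℂ _ _) (ContinuousLinearMap.fst ℂ _ _)

lemma dAnti_inner_vv : dAnti X (fun q => inner ℂ q.2 q.2) p = inner ℂ X.2 p.2 :=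
  dAnti_inner X (ContinuousLinearMap.snd ℂ _ _) (ContinuousLinearMap.snd ℂ _ _)

lemma dAnti_inner_zz : dAnti X (fun q => inner ℂ q.1 q.1) p = inner ℂ X.1 p.1 :=
  dAnti_inner X (ContinuousLinearMap.fst ℂ _ _) (ContinuousLinearMap.fst ℂ _ _)

variable (hp : p.2 ≠ 0)
include hp

lemma differentiableAt_angle : DifferentiableAt ℝ (angle : TCn n → ℂ) p := by
  have h := ((differentiable_inner_zv (n := n) p).fun_mul (differentiable_inner_vz p)).fun_mul
    ((differentiable_inner_vv p).fun_inv (inner_self_ne_zero.2 hp))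
  simp only [← div_eq_mul_inv] at h
  exact h

lemma dHol_angle : dHol X angle p = (inner ℂ p.1 X.2 * inner ℂ p.2 p.1
    + inner ℂ p.1 p.2 * inner ℂ p.2 X.1 - angle p * inner ℂ p.2 X.2) / inner ℂ p.2 p.2 := by
  change dHol X (fun q => inner ℂ q.1 q.2 * inner ℂ q.2 q.1 / inner ℂ q.2 q.2) p = _
  rw [dHol_div X ((differentiable_inner_zv p).fun_mul (differentiable_inner_vz p))
    (differentiable_inner_vv p) (inner_self_ne_zero.2 hp),
    dHol_mul X (differentiable_inner_zv p) (differentiable_inner_vz p), dHol_inner_zv,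
    dHol_inner_vz, dHol_inner_vv]
  rfl

lemma dAnti_angle : dAnti X angle p = (inner ℂ X.1 p.2 * inner ℂ p.2 p.1
    + inner ℂ p.1 p.2 * inner ℂ X.2 p.1 - angle p * inner ℂ X.2 p.2) / inner ℂ p.2 p.2 := by
  change dAnti X (fun q => inner ℂ q.1 q.2 * inner ℂ q.2 q.1 / inner ℂ q.2 q.2) p = _
  rw [dAnti_div X ((differentiable_inner_zv p).fun_mul (differentiable_inner_vz p))
    (differentiable_inner_vv p) (inner_self_ne_zero.2 hp),
    dAnti_mul X (differentiable_inner_zv p) (differentiable_inner_vz p), dAnti_inner_zv,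
    dAnti_inner_vz, dAnti_inner_vv]
  rfl

lemma differentiableAt_exponent :
    DifferentiableAt ℝ (fun q : TCn n => a * inner ℂ q.1 q.1 + b * angle q : TCn n → ℂ) p :=
  ((differentiable_inner_zz p).const_mul _).fun_add ((differentiableAt_angle hp).const_mul _)

lemma differentiableAt_weight : DifferentiableAt ℝ (weight a b : TCn n → ℂ) p :=
  (differentiableAt_exponent a b hp).cexp

lemma dHol_weight :
    dHol X (weight a b) p = weight a b p * (a * inner ℂ p.1 X.1 + b * dHol X angle p) := by
  change dHol X (fun q => Complex.exp (a * inner ℂ q.1 q.1 + b * angle q)) p = _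
  rw [dHol_cexp X (differentiableAt_exponent a b hp),
    dHol_add X ((differentiable_inner_zz p).const_mul _) ((differentiableAt_angle hp).const_mul _),
    dHol_const_mul X _ (differentiable_inner_zz p), dHol_const_mul X _ (differentiableAt_angle hp),
    dHol_inner_zz]
  rfl

lemma dAnti_weight :
    dAnti X (weight a b) p = weight a b p * (a * inner ℂ X.1 p.1 + b * dAnti X angle p) := by
  change dAnti X (fun q => Complex.exp (a * inner ℂ q.1 q.1 + b * angle q)) p = _
  rw [dAnti_cexp X (differentiableAt_exponent a b hp),
    dAnti_add X ((differentiable_inner_zz p).const_mul _) ((differentiableAt_angle hp).const_mul _),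
    dAnti_const_mul X _ (differentiable_inner_zz p),
    dAnti_const_mul X _ (differentiableAt_angle hp), dAnti_inner_zz]
  rfl

omit hp in
/-- The vertical derivative `∂G / ∂v̄^τ`, away from the zero section. -/
noncomputable def vertGrad (τ : Fin n) (q : TCn n) : ℂ :=
  weight a b q * ((1 - b * angle q) * q.2 τ + b * (inner ℂ q.1 q.2 * q.1 τ))

lemma dvBar_expMetric (τ : Fin n) :
    dvBar τ (fun q => (expMetric a b q : ℂ)) p = vertGrad a b τ p := by
  have hr : inner ℂ p.2 p.2 ≠ 0 := inner_self_ne_zero.2 hp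
  simp only [ofReal_expMetric, dvBar]
  rw [dAnti_mul _ (differentiable_inner_vv p) (differentiableAt_weight a b hp), dAnti_inner_vv,
    dAnti_weight a b _ hp, dAnti_angle _ hp]
  simp only [stdVec, EuclideanSpace.inner_single_left, inner_zero_left, map_one, vertGrad]
  field_simp
  ring

lemma differentiableAt_vertGrad_factor (τ : Fin n) : DifferentiableAt ℝ
    (fun q : TCn n => (1 - b * angle q) * q.2 τ + b * (inner ℂ q.1 q.2 * q.1 τ)) p :=
  (((differentiableAt_const _).fun_sub ((differentiableAt_angle hp).const_mul _)).fun_mul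
    (differentiable_v τ p)).fun_add
    (((differentiable_inner_zv p).fun_mul (differentiable_z τ p)).const_mul _)

lemma dHol_vertGrad (τ : Fin n) : dHol X (vertGrad a b τ) p =
    weight a b p * ((a * inner ℂ p.1 X.1 + b * dHol X angle p) *
        ((1 - b * angle p) * p.2 τ + b * (inner ℂ p.1 p.2 * p.1 τ))
      + (1 - b * angle p) * X.2 τ - b * dHol X angle p * p.2 τ
      + b * (inner ℂ p.1 X.2 * p.1 τ + inner ℂ p.1 p.2 * X.1 τ)) := by
  have h1 : DifferentiableAt ℝ (fun q : TCn n => 1 - b * angle q) p :=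
    (differentiableAt_const _).fun_sub ((differentiableAt_angle hp).const_mul _)
  have h2 := (differentiable_inner_zv p).fun_mul (differentiable_z τ p)
  change dHol X (fun q => weight a b q *
    ((1 - b * angle q) * q.2 τ + b * (inner ℂ q.1 q.2 * q.1 τ))) p = _
  rw [dHol_mul X (differentiableAt_weight a b hp) (differentiableAt_vertGrad_factor b hp τ),
    dHol_weight a b X hp, dHol_add X (h1.fun_mul (differentiable_v τ p)) (h2.const_mul _),
    dHol_mul X h1 (differentiable_v τ p), dHol_const_mul X _ h2,
    dHol_mul X (differentiable_inner_zv p) (differentiable_z τ p), dHol_inner_zv, dHol_z, dHol_v,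
    dHol_sub X (differentiableAt_const _) ((differentiableAt_angle hp).const_mul _), dHol_const,
    dHol_const_mul X _ (differentiableAt_angle hp)]
  ring

/-- Second derivatives need the formula for the first on a neighbourhood. -/
lemma eventually_dvBar_expMetric (τ : Fin n) :
    dvBar τ (fun q => (expMetric a b q : ℂ)) =ᶠ[nhds p] vertGrad a b τ := by
  filter_upwards [(continuous_snd.continuousAt (x := p)).eventually_ne hp] with q hq
  exact dvBar_expMetric a b hq τ

lemma leviEntry_expMetric (α τ : Fin n) : leviEntry (expMetric a b) α τ p =
    weight a b p * ((1 - b * angle p) * (if α = τ then 1 else 0) + b * (conj (p.1 α) * p.1 τ)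
      + b ^ 2 / inner ℂ p.2 p.2 * ((conj (p.1 α) * inner ℂ p.2 p.1 - angle p * conj (p.2 α)) *
          (p.1 τ * inner ℂ p.1 p.2 - angle p * p.2 τ))) := by
  have hr : inner ℂ p.2 p.2 ≠ 0 := inner_self_ne_zero.2 hp
  rw [leviEntry, dv, dHol_congr _ (eventually_dvBar_expMetric a b hp τ), dHol_vertGrad a b _ hp,
    dHol_angle _ hp]
  simp only [stdVec, EuclideanSpace.inner_single_right, inner_zero_right, one_mul,
    PiLp.single_apply, PiLp.zero_apply, eq_comm (a := τ)]
  field_simp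
  ring

lemma sum_leviEntry_expMetric_mul (τ : Fin n) :
    ∑ β, leviEntry (expMetric a b) β τ p * p.2 β = vertGrad a b τ p := by
  have hr : inner ℂ p.2 p.2 ≠ 0 := inner_self_ne_zero.2 hp
  have h := dHol_vec_sum (F := vertGrad a b τ) (p := p) Finset.univ (fun β => p.2 β)
    (fun β => (0, stdVec β))
  -- `θ` is invariant under complex scaling of `v`.
  have hA : dHol (0, p.2) angle p = 0 := by
    rw [dHol_angle _ hp]
    simp only [inner_zero_right, mul_zero, add_zero, angle]
    field_simp
    ring
  rw [sum_smul_stdVec_right, dHol_vertGrad a b _ hp, hA] at h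
  simp only [leviEntry, dv, dHol_congr _ (eventually_dvBar_expMetric a b hp τ), mul_comm _ (p.2 _)]
  rw [h, vertGrad]
  simp

/-- This is the derivative of `vertGrad` along `(v, 0)`. The weight contributes `(a + b) ⟨z, v⟩`,
and the two terms from differentiating the bracket cancel. -/
lemma sum_dz_dvBar_expMetric_mul (τ : Fin n) :
    ∑ μ, dz μ (dvBar τ fun q => (expMetric a b q : ℂ)) p * p.2 μ =
      (a + b) * inner ℂ p.1 p.2 * vertGrad a b τ p := by
  have hr : inner ℂ p.2 p.2 ≠ 0 := inner_self_ne_zero.2 hp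
  have h := dHol_vec_sum (F := vertGrad a b τ) (p := p) Finset.univ (fun β => p.2 β)
    (fun β => (stdVec β, 0))
  have hA : dHol (p.2, 0) angle p = inner ℂ p.1 p.2 := by
    rw [dHol_angle _ hp]
    simp only [inner_zero_right, mul_zero, sub_zero, zero_mul, zero_add]
    field_simp
  rw [sum_smul_stdVec_left, dHol_vertGrad a b _ hp, hA] at h
  simp only [dz, dHol_congr _ (eventually_dvBar_expMetric a b hp τ), mul_comm _ (p.2 _)]
  rw [h, vertGrad]
  simp only [inner_zero_right, PiLp.zero_apply]
  ring

lemma sum_vertGrad_mul : ∑ τ, vertGrad a b τ p * conj (p.2 τ) = expMetric a b p := by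
  have hr : inner ℂ p.2 p.2 ≠ 0 := inner_self_ne_zero.2 hp
  have h1 : ∑ τ, p.2 τ * conj (p.2 τ) = inner ℂ p.2 p.2 := rfl
  have h2 : ∑ τ, p.1 τ * conj (p.2 τ) = inner ℂ p.2 p.1 := rfl
  have h3 : ∑ τ, vertGrad a b τ p * conj (p.2 τ) = weight a b p * ((1 - b * angle p) *
      ∑ τ, p.2 τ * conj (p.2 τ) + b * inner ℂ p.1 p.2 * ∑ τ, p.1 τ * conj (p.2 τ)) := by
    rw [Finset.mul_sum, Finset.mul_sum, ← Finset.sum_add_distrib, Finset.mul_sum]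
    refine Finset.sum_congr rfl fun τ _ => ?_
    rw [vertGrad]; ring
  rw [h3, h1, h2, ofReal_expMetric, angle]
  field_simp
  ring

end ExpMetric

/-! ### Positivity of the Levi matrix -/

section Pseudoconvex

variable {a b : ℝ} {p : TCn n}

/-- Cauchy–Schwarz for the bilinear pairing, without conjugation, which is the one occurring in the
Levi form. -/
lemma norm_sum_mul_sq_le (z x : Cn n) : ‖∑ τ, z τ * x τ‖ ^ 2 ≤ ‖z‖ ^ 2 * ‖x‖ ^ 2 := by
  rw [EuclideanSpace.norm_sq_eq, EuclideanSpace.norm_sq_eq]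
  refine le_trans ?_ (Finset.sum_mul_sq_le_sq_mul_sq _ _ _)
  gcongr
  exact (norm_sum_le _ _).trans (by simp)

lemma ratio_le (z v : Cn n) : ‖inner ℂ z v‖ ^ 2 / ‖v‖ ^ 2 ≤ ‖z‖ ^ 2 := by
  rcases eq_or_ne v 0 with rfl | hv
  · simp
  · rw [div_le_iff₀ (by positivity), ← mul_pow]
    gcongr
    exact norm_inner_le_norm z v

/-- The `y`-term is nonnegative and can be dropped. The coefficient `b` may be negative, so the
`u`-term is kept together with the identity. -/
lemma posDef_smul_one_add_vecMulVec {c m b d : ℝ} (hc : 0 < c) (hd : 0 ≤ d) (u y : Fin n → ℂ)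
    (h : ∀ x : Cn n, x ≠ 0 → 0 < m * ‖x‖ ^ 2 + b * ‖∑ τ, u τ * x τ‖ ^ 2) :
    ((c : ℂ) • ((m : ℂ) • (1 : Matrix (Fin n) (Fin n) ℂ) + (b : ℂ) • Matrix.vecMulVec (star u) u
      + (d : ℂ) • Matrix.vecMulVec (star y) y)).PosDef := by
  refine Matrix.PosDef.of_dotProduct_mulVec_pos ?_ fun x hx => ?_
  · simp only [Matrix.IsHermitian, Matrix.conjTranspose_smul, Matrix.conjTranspose_add,
      Matrix.conjTranspose_one, Matrix.conjTranspose_vecMulVec, star_star, RCLike.star_def,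
      Complex.conj_ofReal]
  · have hform : ∀ u : Fin n → ℂ,
        star x ⬝ᵥ (Matrix.vecMulVec (star u) u).mulVec x = ((‖∑ τ, u τ * x τ‖ ^ 2 : ℝ) : ℂ) := by
      intro u
      rw [Matrix.vecMulVec_mulVec]
      have h1 : star x ⬝ᵥ star u = conj (∑ τ, u τ * x τ) := by
        simp [dotProduct, map_sum, mul_comm]
      have h2 : u ⬝ᵥ x = ∑ τ, u τ * x τ := rfl
      simp only [dotProduct_smul, h1, h2, MulOpposite.smul_eq_mul_unop, MulOpposite.unop_op]
      rw [Complex.conj_mul']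
      push_cast
      rfl
    have hone : star x ⬝ᵥ x = ((‖(WithLp.toLp 2 x : Cn n)‖ ^ 2 : ℝ) : ℂ) := by
      rw [EuclideanSpace.norm_sq_eq]
      simp [dotProduct, Complex.conj_mul']
    have hx' := h (WithLp.toLp 2 x) fun h => hx (by simpa using h)
    simp only [Matrix.smul_mulVec, Matrix.add_mulVec, Matrix.one_mulVec, dotProduct_smul,
      dotProduct_add, hform, hone, smul_eq_mul]
    rw [← Complex.ofReal_mul, ← Complex.ofReal_mul, ← Complex.ofReal_mul, ← Complex.ofReal_add,
      ← Complex.ofReal_add, ← Complex.ofReal_mul, Complex.zero_lt_real]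
    exact mul_pos hc (add_pos_of_pos_of_nonneg hx' (by positivity))

lemma posDef_leviMatrix_expMetric (hp : p.2 ≠ 0) (hb : |b| * ‖p.1‖ ^ 2 < 1) :
    (leviMatrix (expMetric a b) p).PosDef := by
  have hM : leviMatrix (expMetric a b) p =
      (Real.exp (a * ‖p.1‖ ^ 2 + b * (‖inner ℂ p.1 p.2‖ ^ 2 / ‖p.2‖ ^ 2)) : ℂ) •
      (((1 - b * (‖inner ℂ p.1 p.2‖ ^ 2 / ‖p.2‖ ^ 2) : ℝ) : ℂ) • (1 : Matrix (Fin n) (Fin n) ℂ)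
      + (b : ℂ) • Matrix.vecMulVec (star p.1.ofLp) p.1.ofLp
      + ((b ^ 2 / ‖p.2‖ ^ 2 : ℝ) : ℂ) • Matrix.vecMulVec
        (star fun τ => p.1 τ * inner ℂ p.1 p.2 - angle p * p.2 τ)
        (fun τ => p.1 τ * inner ℂ p.1 p.2 - angle p * p.2 τ)) := by
    ext α τ
    have h1 : conj (angle p) = angle p := by rw [angle_eq, Complex.conj_ofReal]
    have h2 : ((b ^ 2 / ‖p.2‖ ^ 2 : ℝ) : ℂ) = b ^ 2 / inner ℂ p.2 p.2 := by
      rw [inner_self_eq_norm_sq_to_K]; push_cast; rfl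
    simp only [leviMatrix, Matrix.of_apply, leviEntry_expMetric a b hp, ← weight_eq,
      Complex.ofReal_sub, Complex.ofReal_mul, ← angle_eq, h2, Matrix.smul_apply, Matrix.add_apply,
      Matrix.one_apply, Matrix.vecMulVec_apply, smul_eq_mul, Pi.star_apply, RCLike.star_def,
      map_sub, map_mul, h1, inner_conj_symm, Complex.ofReal_one]
  rw [hM]
  refine posDef_smul_one_add_vecMulVec (Real.exp_pos _) (by positivity) _ _ fun x hx => ?_
  have hx' : 0 < ‖x‖ ^ 2 := by positivity
  have hcs := norm_sum_mul_sq_le p.1 x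
  have ht0 : 0 ≤ ‖inner ℂ p.1 p.2‖ ^ 2 / ‖p.2‖ ^ 2 := by positivity
  have ht1 := ratio_le p.1 p.2
  have hm0 : 0 ≤ ‖∑ τ, p.1 τ * x τ‖ ^ 2 := by positivity
  generalize ‖inner ℂ p.1 p.2‖ ^ 2 / ‖p.2‖ ^ 2 = t at *
  generalize ‖∑ τ, p.1 τ * x τ‖ ^ 2 = m at *
  generalize ‖x‖ ^ 2 = s at *
  -- For `b ≥ 0` the only danger is `1 - bθ`, controlled by `θ ≤ ‖z‖²`. For `b ≤ 0` it is the
  -- rank-one term, controlled by Cauchy–Schwarz.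
  rcases le_total 0 b with h | h
  · rw [abs_of_nonneg h] at hb
    have : 0 < (1 - b * t) * s := mul_pos (by nlinarith) hx'
    have : 0 ≤ b * m := mul_nonneg h hm0
    linarith
  · rw [abs_of_nonpos h] at hb
    have hb0 : 0 ≤ -b := by linarith
    have h1 : 0 < (1 - -b * ‖p.1‖ ^ 2) * s := mul_pos (by linarith) hx'
    have h2 : 0 ≤ -b * (‖p.1‖ ^ 2 * s - m) := mul_nonneg hb0 (by linarith)
    have h3 : 0 ≤ -b * t * s := by positivity
    linarith

end Pseudoconvex

/-! ### Metric axioms, non-quadraticity and the curvature bound -/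

section Metric

variable (a b : ℝ)

lemma isOpen_slitBundle {D : Set (Cn n)} (hD : IsOpen D) : IsOpen (slitBundle D) :=
  (hD.preimage continuous_fst).inter (isOpen_ne.preimage continuous_snd)

lemma contDiffOn_expMetric (D : Set (Cn n)) :
    ContDiffOn ℝ ∞ (expMetric a b : TCn n → ℝ) (slitBundle D) := by
  intro q hq
  have hr : ‖q.2‖ ^ 2 ≠ 0 := by have := hq.2; positivity
  have hv : ContDiffAt ℝ ∞ (fun q : TCn n => ‖q.2‖ ^ 2) q := (contDiff_snd.norm_sq ℂ).contDiffAt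
  have hz : ContDiffAt ℝ ∞ (fun q : TCn n => ‖q.1‖ ^ 2) q := (contDiff_fst.norm_sq ℂ).contDiffAt
  have hw : ContDiffAt ℝ ∞ (fun q : TCn n => ‖inner ℂ q.1 q.2‖ ^ 2) q :=
    ((contDiff_fst.inner ℂ contDiff_snd).norm_sq ℂ).contDiffAt
  exact (hv.mul ((contDiffAt_const.mul hz).add
    (contDiffAt_const.mul (hw.div hv hr))).exp).contDiffWithinAt

lemma expMetric_pos {p : TCn n} (hp : p.2 ≠ 0) : 0 < expMetric a b p := by
  unfold expMetric; positivity

lemma expMetric_le (p : TCn n) :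
    expMetric a b p ≤ ‖p.2‖ ^ 2 * Real.exp ((|a| + |b|) * ‖p.1‖ ^ 2) := by
  unfold expMetric
  gcongr
  rw [add_mul]
  have h0 : 0 ≤ ‖inner ℂ p.1 p.2‖ ^ 2 / ‖p.2‖ ^ 2 := by positivity
  refine add_le_add (mul_le_mul_of_nonneg_right (le_abs_self a) (by positivity)) ?_
  exact mul_le_mul (le_abs_self b) (ratio_le _ _) h0 (abs_nonneg b)

/-- At the zero section `θ` has no limit in general, but it stays bounded, so the factor `‖v‖²`
forces `G → 0`. -/
lemma continuous_expMetric : Continuous (expMetric a b : TCn n → ℝ) := by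
  rw [continuous_iff_continuousAt]
  intro p
  by_cases hp : p.2 = 0
  · have h0 : expMetric a b p = 0 := by simp [expMetric, hp]
    have h1 : Filter.Tendsto (fun q : TCn n => ‖q.2‖ ^ 2 * Real.exp ((|a| + |b|) * ‖q.1‖ ^ 2))
        (nhds p) (nhds 0) := by
      have : Continuous (fun q : TCn n => ‖q.2‖ ^ 2 * Real.exp ((|a| + |b|) * ‖q.1‖ ^ 2)) := by
        fun_prop
      have h := this.tendsto p
      simpa [hp] using h
    rw [ContinuousAt, h0]
    exact squeeze_zero (fun q => by unfold expMetric; positivity) (expMetric_le a b) h1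
  · exact ((contDiffOn_expMetric a b Set.univ).contDiffAt
      ((isOpen_slitBundle isOpen_univ).mem_nhds ⟨trivial, hp⟩)).continuousAt

lemma isStronglyPseudoconvex_expMetric {D : Set (Cn n)} (hb : ∀ z ∈ D, |b| * ‖z‖ ^ 2 < 1) :
    IsStronglyPseudoconvex D (expMetric a b) where
  continuousOn := (continuous_expMetric a b).continuousOn
  smoothOn := contDiffOn_expMetric a b D
  nonneg z _ v := by unfold expMetric; positivity
  eq_zero_iff z _ v := by simp [expMetric, (Real.exp_pos _).ne']
  homogeneous z _ v c := by
    rcases eq_or_ne c 0 with rfl | hc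
    · simp [expMetric]
    · have h : (‖c‖ * ‖inner ℂ z v‖) ^ 2 / (‖c‖ * ‖v‖) ^ 2 = ‖inner ℂ z v‖ ^ 2 / ‖v‖ ^ 2 := by
        rw [mul_pow, mul_pow, mul_div_mul_left _ _ (by positivity)]
      simp only [expMetric, norm_smul, inner_smul_right, norm_mul, h]
      ring
  posDef p hp := posDef_leviMatrix_expMetric hp.2 (hb _ hp.1)

lemma IsHermitianQuadratic.parallelogram {D : Set (Cn n)} {G : TCn n → ℝ}
    (h : IsHermitianQuadratic D G) {z : Cn n} (hz : z ∈ D) (u v : Cn n) :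
    G (z, u + v) + G (z, u - v) = 2 * (G (z, u) + G (z, v)) := by
  obtain ⟨g, hg⟩ := h
  have : ((G (z, u + v) + G (z, u - v) : ℝ) : ℂ) = ((2 * (G (z, u) + G (z, v)) : ℝ) : ℂ) := by
    push_cast
    simp only [hg z hz, ← Finset.sum_add_distrib, Finset.mul_sum]
    refine Finset.sum_congr rfl fun α _ => Finset.sum_congr rfl fun β _ => ?_
    simp only [PiLp.add_apply, PiLp.sub_apply, map_add, map_sub]
    ring
  exact_mod_cast this

/-- The orthogonal complement of a line is nonzero because `n ≥ 2`. -/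
lemma exists_orthogonal_norm_eq (hn : 2 ≤ n) (z : Cn n) :
    ∃ e : Cn n, inner ℂ z e = 0 ∧ ‖e‖ = ‖z‖ := by
  obtain ⟨e, he, he0⟩ : ∃ e ∈ (ℂ ∙ z)ᗮ, e ≠ 0 := by
    refine Submodule.exists_mem_ne_zero_of_ne_bot fun h => ?_
    have h1 := Submodule.finrank_add_finrank_orthogonal (ℂ ∙ z)
    rw [h, finrank_bot, finrank_euclideanSpace, Fintype.card_fin] at h1
    have h2 := finrank_span_le_card (R := ℂ) ({z} : Set (Cn n))
    simp at h2
    omega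
  have hne : ‖e‖ ≠ 0 := norm_ne_zero_iff.2 he0
  refine ⟨((‖z‖ / ‖e‖ : ℝ) : ℂ) • e, ?_, ?_⟩
  · rw [inner_smul_right, Submodule.mem_orthogonal_singleton_iff_inner_right.1 he, mul_zero]
  · rw [norm_smul, Complex.norm_real, Real.norm_of_nonneg (by positivity)]
    field_simp

lemma exists_mem_ne_zero_of_isOpen (hn : 2 ≤ n) {D : Set (Cn n)} (hD : IsOpen D)
    (hne : D.Nonempty) : ∃ z ∈ D, z ≠ 0 := by
  have : Nontrivial (Fin n) := Fin.nontrivial_iff_two_le.2 hn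
  obtain ⟨z, hz⟩ := hne
  have h := (dense_compl_singleton (0 : Cn n)).inter_open_nonempty D hD ⟨z, hz⟩
  obtain ⟨y, hy, hy0⟩ := h
  exact ⟨y, hy, hy0⟩

lemma not_isHermitianQuadratic_expMetric (hn : 2 ≤ n) {D : Set (Cn n)} (hD : IsOpen D)
    (hne : D.Nonempty) (hb : b ≠ 0) : ¬ IsHermitianQuadratic D (expMetric a b) := by
  intro h
  obtain ⟨z, hz, hz0⟩ := exists_mem_ne_zero_of_isOpen hn hD hne
  obtain ⟨e, hze, he⟩ := exists_orthogonal_norm_eq hn z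
  have hpos : 0 < ‖z‖ := norm_pos_iff.2 hz0
  have hadd : ‖z + e‖ ^ 2 = 2 * ‖z‖ ^ 2 := by
    rw [@norm_add_sq ℂ, hze, he]; simp; ring
  have hsub : ‖z - e‖ ^ 2 = 2 * ‖z‖ ^ 2 := by
    rw [@norm_sub_sq ℂ, hze, he]; simp; ring
  have hzz : ‖inner ℂ z z‖ = ‖z‖ ^ 2 := by
    rw [inner_self_eq_norm_sq_to_K]; simp
  have key := h.parallelogram hz z e
  simp only [expMetric, hadd, hsub, inner_add_right, inner_sub_right, hze, add_zero, sub_zero, hzz,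
    he, norm_zero] at key
  have h1 : (‖z‖ ^ 2) ^ 2 / (2 * ‖z‖ ^ 2) = ‖z‖ ^ 2 / 2 := by field_simp
  have h2 : (‖z‖ ^ 2) ^ 2 / ‖z‖ ^ 2 = ‖z‖ ^ 2 := by field_simp
  simp only [h1, h2, Real.exp_add] at key
  set x := Real.exp (b * (‖z‖ ^ 2 / 2)) with hx
  have h3 : Real.exp (b * ‖z‖ ^ 2) = x * x := by
    rw [hx, ← Real.exp_add]; ring_nf
  -- The vectors `z ± e` have `θ = ‖z‖² / 2`, while `z` has `θ = ‖z‖²` and `e` has `θ = 0`. The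
  -- parallelogram law becomes `2x = x² + 1`.
  have h4 : ‖z‖ ^ 2 * Real.exp (a * ‖z‖ ^ 2) * (x - 1) ^ 2 = 0 := by
    rw [h3] at key
    norm_num at key
    linarith
  have h5 : x = 1 := by
    have : ‖z‖ ^ 2 * Real.exp (a * ‖z‖ ^ 2) ≠ 0 := by positivity
    have := (mul_eq_zero.1 h4).resolve_left this
    nlinarith
  rw [hx, Real.exp_eq_one_iff] at h5
  exact mul_ne_zero hb (by positivity) h5

lemma holSectCurv_expMetric {D : Set (Cn n)} (hD : IsOpen D) (hb : ∀ z ∈ D, |b| * ‖z‖ ^ 2 < 1)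
    {p : TCn n} (hp : p ∈ slitBundle D) :
    holSectCurv (expMetric a b) p = -(2 * (a + b) * ‖p.2‖ ^ 2 / expMetric a b p) := by
  have hU := isOpen_slitBundle hD
  have hG : ContDiffOn ℝ ∞ (fun q : TCn n => (expMetric a b q : ℂ)) (slitBundle D) :=
    Complex.ofRealCLM.contDiff.comp_contDiffOn (contDiffOn_expMetric a b D)
  have hL : ∀ q ∈ slitBundle D, IsUnit (leviMatrix (expMetric a b) q).det := fun q hq =>
    (Matrix.isUnit_iff_isUnit_det _).1 (posDef_leviMatrix_expMetric hq.2 (hb _ hq.1)).isUnit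
  have hE : ∀ q ∈ slitBundle D, ∀ τ, ∑ β, leviEntry (expMetric a b) β τ q * q.2 β =
      dvBar τ (fun q => (expMetric a b q : ℂ)) q := fun q hq τ => by
    rw [sum_leviEntry_expMetric_mul a b hq.2, dvBar_expMetric a b hq.2]
  have hN : ∀ q ∈ slitBundle D, ∀ α, ∑ μ, nlConn (expMetric a b) α μ q * q.2 μ =
      (a + b) * (inner ℂ q.1 q.2 * q.2 α) := fun q hq α => by
    simp only [nlConn, Finset.sum_mul]
    rw [Finset.sum_comm]
    simp only [mul_assoc, ← Finset.mul_sum, sum_dz_dvBar_expMetric_mul a b hq.2,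
      ← sum_leviEntry_expMetric_mul a b hq.2]
    have h : ∀ γ, leviInv (expMetric a b) α γ q * ((a + b : ℂ) * (inner ℂ q.1 q.2 *
        ∑ β, leviEntry (expMetric a b) β γ q * q.2 β)) = (a + b) * (inner ℂ q.1 q.2 *
        ∑ β, leviInv (expMetric a b) α γ q * leviEntry (expMetric a b) β γ q * q.2 β) := by
      intro γ
      simp only [mul_assoc, ← Finset.mul_sum]
      ring
    simp only [h, ← Finset.mul_sum]
    rw [Finset.sum_comm]
    simp only [← Finset.sum_mul, sum_leviInv_mul_leviEntry (hL q hq)]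
    simp
  have hR : ∀ α, ∑ β, curvForm (expMetric a b) p (radialHor (expMetric a b) p)
      (radialHor (expMetric a b) p) α β * p.2 β = -((a + b) * inner ℂ p.2 p.2) * p.2 α := by
    intro α
    rw [sum_curvForm_radialHor_mul hU hG hL hE hp]
    -- The function `(a + b) ⟨z, v⟩ v^α` does not involve `v̄`, so the vertical part of `δ_ν̄`
    -- contributes nothing and `∂/∂z̄^ν` turns `⟨z, v⟩` into `v^ν`.
    have h : ∀ ν, dAnti (deltaVec (expMetric a b) ν p)
        (fun q => ∑ μ, nlConn (expMetric a b) α μ q * q.2 μ) p = (a + b) * (p.2 ν * p.2 α) := by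
      intro ν
      rw [dAnti_congr _ (Filter.eventually_of_mem (hU.mem_nhds hp) fun q hq => hN q hq α),
        dAnti_const_mul _ _ ((differentiable_inner_zv p).fun_mul (differentiable_v α p)),
        dAnti_mul _ (differentiable_inner_zv p) (differentiable_v α p), dAnti_v, dAnti_inner_zv]
      simp only [deltaVec, stdVec, EuclideanSpace.inner_single_left, map_one, one_mul, mul_zero,
        add_zero]
    have h2 : ∑ ν, p.2 ν * conj (p.2 ν) = inner ℂ p.2 p.2 := rfl
    simp only [h, ← h2, Finset.mul_sum, neg_mul, Finset.sum_mul]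
    congr 1
    exact Finset.sum_congr rfl fun ν _ => by ring
  have hS : ∑ α, ∑ γ, leviEntry (expMetric a b) α γ p *
      (-((a + b : ℂ) * inner ℂ p.2 p.2) * p.2 α) * conj (p.2 γ) =
      ((-((a + b) * ‖p.2‖ ^ 2) * expMetric a b p : ℝ) : ℂ) := by
    have h2 : ((-((a + b) * ‖p.2‖ ^ 2) : ℝ) : ℂ) = -((a + b : ℂ) * inner ℂ p.2 p.2) := by
      rw [inner_self_eq_norm_sq_to_K]; push_cast; rfl
    -- Euler's identity in `v` and then in `v̄` gives `∑ G_{αγ̄} v^α v̄^γ = G`.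
    rw [Complex.ofReal_mul, h2, ← sum_vertGrad_mul a b hp.2, Finset.sum_comm, Finset.mul_sum]
    refine Finset.sum_congr rfl fun γ _ => ?_
    rw [← sum_leviEntry_expMetric_mul a b hp.2, Finset.sum_mul, Finset.mul_sum]
    exact Finset.sum_congr rfl fun α _ => by ring
  have hpos := (expMetric_pos a b hp.2).ne'
  simp only [holSectCurv, hR]
  rw [hS, Complex.ofReal_re]
  field_simp

lemma exists_holSectCurv_expMetric_le {D : Set (Cn n)} (hD : IsOpen D)
    (hbdd : Bornology.IsBounded D) (hab : 0 < a + b) (hb : ∀ z ∈ D, |b| * ‖z‖ ^ 2 < 1) :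
    ∃ K : ℝ, 0 < K ∧ ∀ p ∈ slitBundle D, holSectCurv (expMetric a b) p ≤ -K := by
  obtain ⟨R, hR⟩ := hbdd.exists_norm_le
  -- The denominator bounds `G / ‖v‖²` over `D`, by `expMetric_le` and `‖z‖ ≤ R`.
  refine ⟨2 * (a + b) / Real.exp ((|a| + |b|) * R ^ 2), by positivity, fun p hp => ?_⟩
  rw [holSectCurv_expMetric a b hD hb hp, neg_le_neg_iff,
    div_le_div_iff₀ (Real.exp_pos _) (expMetric_pos a b hp.2), mul_assoc (2 * (a + b))]
  refine mul_le_mul_of_nonneg_left ((expMetric_le a b p).trans ?_) (by positivity)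
  gcongr
  exact hR _ hp.1

end Metric

end ComplexFinsler

theorem theorem1p5 (n : ℕ) (hn : 2 ≤ n) (D : Set (ComplexFinsler.Cn n))
    (hDopen : IsOpen D) (hDconn : IsConnected D) (hDbdd : Bornology.IsBounded D) :
    (∃ a b : ℝ, a ≠ 0 ∧
      ComplexFinsler.IsStronglyPseudoconvex D (ComplexFinsler.expMetric a b) ∧
      ¬ ComplexFinsler.IsHermitianQuadratic D (ComplexFinsler.expMetric a b) ∧
      ∃ K : ℝ, 0 < K ∧ ∀ p ∈ ComplexFinsler.slitBundle D,
        ComplexFinsler.holSectCurv (ComplexFinsler.expMetric a b) p ≤ -K) ∧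
    (∀ a b : ℝ, b ≠ 0 → 0 < a + b → (∀ z ∈ D, |b| * ‖z‖ ^ 2 < 1) →
      ComplexFinsler.IsStronglyPseudoconvex D (ComplexFinsler.expMetric a b) ∧
      ¬ ComplexFinsler.IsHermitianQuadratic D (ComplexFinsler.expMetric a b) ∧
      ∃ K : ℝ, 0 < K ∧ ∀ p ∈ ComplexFinsler.slitBundle D,
        ComplexFinsler.holSectCurv (ComplexFinsler.expMetric a b) p ≤ -K) := by
  have main : ∀ a b : ℝ, b ≠ 0 → 0 < a + b → (∀ z ∈ D, |b| * ‖z‖ ^ 2 < 1) →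
      ComplexFinsler.IsStronglyPseudoconvex D (ComplexFinsler.expMetric a b) ∧
      ¬ ComplexFinsler.IsHermitianQuadratic D (ComplexFinsler.expMetric a b) ∧
      ∃ K : ℝ, 0 < K ∧ ∀ p ∈ ComplexFinsler.slitBundle D,
        ComplexFinsler.holSectCurv (ComplexFinsler.expMetric a b) p ≤ -K :=
    fun a b hb hab hD => ⟨ComplexFinsler.isStronglyPseudoconvex_expMetric a b hD,
      ComplexFinsler.not_isHermitianQuadratic_expMetric a b hn hDopen hDconn.nonempty hb,
      ComplexFinsler.exists_holSectCurv_expMetric_le a b hDopen hDbdd hab hD⟩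
  refine ⟨?_, main⟩
  obtain ⟨R, hR⟩ := hDbdd.exists_norm_le
  have hpos : 0 < (R ^ 2 + 1)⁻¹ := by positivity
  -- With this `b`, `|b| ‖z‖² ≤ R² / (R² + 1) < 1` on `D`.
  refine ⟨1, (R ^ 2 + 1)⁻¹, one_ne_zero, main 1 _ hpos.ne' (by positivity) fun z hz => ?_⟩
  rw [abs_of_pos hpos, inv_mul_lt_iff₀ (by positivity), mul_one]
  have : ‖z‖ ^ 2 ≤ R ^ 2 := by gcongr; exact hR z hz
  linarith
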